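/- Let $\ell_2$ be the Hilbert space of square summable complex sequences indexed by $\mathbb N$. For $y\in\ell_2$ let $y\otimes y := y\,y^*$ denote the operator $z\mapsto \langle z,y\rangle\, y$ on $\ell_2$ (inner product linear in the first argument), i.e. the infinite matrix $(y_k\overline{y_l})_{k,l}$, and let $\|\cdot\|_{2\to2}$ be the operator norm on $\ell_2$. Let $n\ge 3$ be an integer, $r>1$ and $M>0$. Let $y^1,\dots,y^n$ be independent, identically distributed random elements of $\ell_2$ on a probability space $(\Omega,\mathcal A,\mathbb P)$ such that $\|y^i\|_2\le M$ almost surely for all $i$, and put $\Lambda := \mathbb E\, y^i\otimes y^i$ (the same for every $i$). Then $$\mathbb P\Big(\Big\|\frac1n\sum_{i=1}^n y^i\otimes y^i-\Lambda\Big\|_{2\to2}\ge F\Big)\le 2^{3/4}\,n^{1-r},$$ where $$F:=\max\Big\{\frac{8r\log n}{n}\,M^2\kappa^2,\ \|\Lambda\|_{2\to2}\Big\},\qquad \kappa:=\frac{1+\sqrt5}{2},$$ and $\log$ is the natural logarithm. -/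

import Mathlib

open MeasureTheory ProbabilityTheory

/-- The complex sequence space `ℓ₂` of square summable sequences indexed by the natural numbers. -/
abbrev EllTwo : Type := lp (fun _ : ℕ => ℂ) 2

noncomputable section

/-- Random elements of `ℓ₂` are measured with respect to the Borel σ-algebra of the norm. -/
instance : MeasurableSpace EllTwo := borel EllTwo

instance : BorelSpace EllTwo := ⟨rfl⟩

/-- The rank one operator `y ⊗ y = y y^*` on `ℓ₂`, that is `z ↦ ⟨y, z⟩ y`, where the inner
product is conjugate linear in its first argument. -/
def tensorSelf (y : EllTwo) : EllTwo →L[ℂ] EllTwo := InnerProductSpace.rankOne ℂ y y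

end

open scoped InnerProductSpace

/-! Write S for the sum of the y^i ⊗ y^i, Γ = nΛ and D = ‖S - Γ‖. The proof bounds E exp(θD) in
terms of itself.

For fixed vectors h i of norm at most M, let X be the sum of the ε i • (h i ⊗ h i) with random signs
and S its unsigned version. Then E tr X^(2p+2) ≤ (2p+1) M² ‖S‖ E tr X^(2p)
(`sum_re_trace_pow_succ_le`): this is integration by parts in each sign, where a scalar power
inequality replaces commutativity. Iterating and summing a power series gives E exp(θ‖X‖) ≤ 2n
exp(θ²M²‖S‖/2); the dimension is replaced by n because X lives on the span of the h i.

Symmetrization turns this into E exp(θD) ≤ 2n E exp(2θ²M²‖S‖). For θ = 1/(8M²) the new parameter is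
θ/4, so ‖S‖ ≤ ‖Γ‖ + D and Jensen bound the right side by 2n exp(θ‖Γ‖/4) (E exp(θD))^(1/4). Hence (E
exp(θD))³ ≤ (2n)⁴ exp(θ‖Γ‖). Markov's inequality at t = nF ≥ ‖Γ‖ finishes, up to numerical slack. -/

theorem pow_mul_pow_add_pow_mul_pow_le {q m : ℕ} (hqm : Even (q + m)) (a b : ℝ) :
    a ^ q * b ^ m + a ^ m * b ^ q ≤ a ^ (q + m) + b ^ (q + m) := by
  -- The exponents have equal parity, so both powers are increasing in |·| (even case) or both are
  -- increasing on ℝ (odd case), and the two differences have the same sign.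
  suffices h : 0 ≤ (a ^ q - b ^ q) * (a ^ m - b ^ m) by
    rw [pow_add, pow_add]; linarith
  rcases Nat.even_or_odd q with hq | hq
  · have hm : Even m := (Nat.even_add.1 hqm).1 hq
    rw [← hq.pow_abs a, ← hq.pow_abs b, ← hm.pow_abs a, ← hm.pow_abs b]
    rcases le_total |a| |b| with h | h
    · exact mul_nonneg_of_nonpos_of_nonpos (sub_nonpos.2 (by gcongr)) (sub_nonpos.2 (by gcongr))
    · exact mul_nonneg (sub_nonneg.2 (by gcongr)) (sub_nonneg.2 (by gcongr))
  · have hm : Odd m := by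
      by_contra h
      exact (Nat.not_even_iff_odd.2 hq) ((Nat.even_add.1 hqm).2 (Nat.not_odd_iff_even.1 h))
    rcases le_total a b with h | h
    · exact mul_nonneg_of_nonpos_of_nonpos (sub_nonpos.2 (hq.strictMono_pow.monotone h))
        (sub_nonpos.2 (hm.strictMono_pow.monotone h))
    · exact mul_nonneg (sub_nonneg.2 (hq.strictMono_pow.monotone h))
        (sub_nonneg.2 (hm.strictMono_pow.monotone h))

theorem pow_sub_pow_eq_sum_mul_sub_mul {R : Type*} [Ring R] (a b : R) (k : ℕ) :
    a ^ k - b ^ k = ∑ q ∈ Finset.range k, a ^ q * (a - b) * b ^ (k - 1 - q) := by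
  induction k with
  | zero => simp
  | succ k ih =>
    rw [Finset.sum_range_succ]
    have : ∑ q ∈ Finset.range k, a ^ q * (a - b) * b ^ (k + 1 - 1 - q)
        = (∑ q ∈ Finset.range k, a ^ q * (a - b) * b ^ (k - 1 - q)) * b := by
      rw [Finset.sum_mul]
      refine Finset.sum_congr rfl fun q hq => ?_
      have : k + 1 - 1 - q = (k - 1 - q) + 1 := by have := Finset.mem_range.1 hq; omega
      rw [this, pow_succ]
      simp only [mul_assoc]
    rw [this, ← ih]
    simp only [add_tsub_cancel_right, tsub_self, pow_zero, mul_one, pow_succ]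
    noncomm_ring

/-! ### Powers of symmetric operators through eigenvalues -/

section FiniteDimensional

variable {V : Type*} [NormedAddCommGroup V] [InnerProductSpace ℂ V] [FiniteDimensional ℂ V]

namespace LinearMap.IsSymmetric

variable {T W Y : Module.End ℂ V}

theorem pow_apply_eigenvectorBasis (hT : T.IsSymmetric) (k : ℕ) (i : Fin (Module.finrank ℂ V)) :
    (T ^ k) (hT.eigenvectorBasis rfl i)
      = ((hT.eigenvalues rfl i ^ k : ℝ) : ℂ) • hT.eigenvectorBasis rfl i := by
  induction k with
  | zero => simp
  | succ k ih =>
    rw [pow_succ', Module.End.mul_apply, ih, map_smul, hT.apply_eigenvectorBasis, smul_smul]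
    push_cast
    rw [pow_succ]; rfl

theorem inner_pow_apply_self (hT : T.IsSymmetric) (k : ℕ) (v : V) :
    ⟪v, (T ^ k) v⟫_ℂ = ((∑ i, hT.eigenvalues rfl i ^ k * ‖⟪hT.eigenvectorBasis rfl i, v⟫_ℂ‖ ^ 2 : ℝ)
      : ℂ) := by
  rw [← (hT.eigenvectorBasis rfl).sum_inner_mul_inner v]
  push_cast
  refine Finset.sum_congr rfl fun i _ => ?_
  rw [← (hT.pow k) , hT.pow_apply_eigenvectorBasis, inner_smul_left, Complex.conj_ofReal,
    ← inner_conj_symm, mul_left_comm, Complex.conj_mul']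
  push_cast; rfl

theorem re_inner_pow_apply_self (hT : T.IsSymmetric) (k : ℕ) (v : V) :
    (⟪v, (T ^ k) v⟫_ℂ).re
      = ∑ i, hT.eigenvalues rfl i ^ k * ‖⟪hT.eigenvectorBasis rfl i, v⟫_ℂ‖ ^ 2 := by
  rw [hT.inner_pow_apply_self, Complex.ofReal_re]

theorem im_inner_pow_apply_self (hT : T.IsSymmetric) (k : ℕ) (v : V) :
    (⟪v, (T ^ k) v⟫_ℂ).im = 0 := by
  rw [hT.inner_pow_apply_self, Complex.ofReal_im]

/-- Expanding `v` in the two eigenbases, with ‖v‖² as the total weight in each, makes both sides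
double sums over pairs of eigenvalues, and the scalar inequality applies termwise. `W` and `Y` need
not commute. -/
theorem re_inner_pow_mul_re_inner_pow_le (hW : W.IsSymmetric) (hY : Y.IsSymmetric) {q m : ℕ}
    (hqm : Even (q + m)) (v : V) :
    (⟪v, (W ^ q) v⟫_ℂ).re * (⟪v, (Y ^ m) v⟫_ℂ).re + (⟪v, (W ^ m) v⟫_ℂ).re * (⟪v, (Y ^ q) v⟫_ℂ).re
      ≤ ‖v‖ ^ 2 * ((⟪v, (W ^ (q + m)) v⟫_ℂ).re + (⟪v, (Y ^ (q + m)) v⟫_ℂ).re) := by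
  have ha := (hW.eigenvectorBasis rfl).sum_sq_norm_inner_right v
  have hb := (hY.eigenvectorBasis rfl).sum_sq_norm_inner_right v
  rw [mul_add]
  nth_rw 1 [← hb]
  rw [← ha]
  simp only [re_inner_pow_apply_self hW, re_inner_pow_apply_self hY]
  rw [mul_comm (∑ i, ‖⟪hY.eigenvectorBasis rfl i, v⟫_ℂ‖ ^ 2)]
  simp only [Finset.sum_mul_sum, ← Finset.sum_add_distrib]
  refine Finset.sum_le_sum fun i _ => Finset.sum_le_sum fun j _ => ?_
  have h := mul_le_mul_of_nonneg_right
    (pow_mul_pow_add_pow_mul_pow_le hqm (hW.eigenvalues rfl i) (hY.eigenvalues rfl j))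
    (mul_nonneg (sq_nonneg ‖⟪hW.eigenvectorBasis rfl i, v⟫_ℂ‖)
      (sq_nonneg ‖⟪hY.eigenvectorBasis rfl j, v⟫_ℂ‖))
  linarith

theorem re_trace_pow (hT : T.IsSymmetric) (k : ℕ) :
    (LinearMap.trace ℂ V (T ^ k)).re = ∑ i, hT.eigenvalues rfl i ^ k := by
  rw [LinearMap.trace_eq_sum_inner _ (hT.eigenvectorBasis rfl), Complex.re_sum]
  refine Finset.sum_congr rfl fun i _ => ?_
  rw [hT.pow_apply_eigenvectorBasis, inner_smul_right, inner_self_eq_norm_sq_to_K,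
    OrthonormalBasis.norm_eq_one, RCLike.ofReal_one, one_pow, mul_one, Complex.ofReal_re]

theorem norm_pow_two_mul_le_re_trace (hT : T.IsSymmetric) (p : ℕ) (hp : p ≠ 0) :
    ‖LinearMap.toContinuousLinearMap T‖ ^ (2 * p) ≤ (LinearMap.trace ℂ V (T ^ (2 * p))).re := by
  set t := (LinearMap.trace ℂ V (T ^ (2 * p))).re
  have ht : ∀ i, (hT.eigenvalues rfl i ^ 2) ^ p ≤ t := fun i => by
    rw [← pow_mul]
    refine (Finset.single_le_sum (f := fun i => hT.eigenvalues rfl i ^ (2 * p)) (fun i _ => ?_)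
      (Finset.mem_univ i)).trans_eq (hT.re_trace_pow _).symm
    exact (even_two_mul p).pow_nonneg _
  have ht0 : 0 ≤ t := by
    rw [show t = _ from hT.re_trace_pow _]
    exact Finset.sum_nonneg fun i _ => (even_two_mul p).pow_nonneg _
  -- The p-th root of the trace bounds every squared eigenvalue; it stands in for their maximum,
  -- which is unavailable when `V` is trivial.
  set s := t ^ ((p : ℝ)⁻¹) with hs
  have hs0 : 0 ≤ s := by positivity
  have hsp : s ^ p = t := Real.rpow_inv_natCast_pow ht0 hp
  have hev : ∀ i, hT.eigenvalues rfl i ^ 2 ≤ s := fun i =>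
    le_of_pow_le_pow_left₀ hp hs0 ((ht i).trans_eq hsp.symm)
  have hn : ‖LinearMap.toContinuousLinearMap T‖ ≤ √s := by
    refine ContinuousLinearMap.opNorm_le_bound _ (Real.sqrt_nonneg _) fun v => ?_
    refine le_of_sq_le_sq ?_ (by positivity)
    rw [mul_pow, Real.sq_sqrt hs0]
    have h2 : ‖T v‖ ^ 2 = (⟪v, (T ^ 2) v⟫_ℂ).re := by
      rw [pow_two T, Module.End.mul_apply, ← hT, ← inner_self_eq_norm_sq (𝕜 := ℂ)]; rfl
    rw [LinearMap.coe_toContinuousLinearMap', h2, hT.re_inner_pow_apply_self,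
      ← (hT.eigenvectorBasis rfl).sum_sq_norm_inner_right v, Finset.mul_sum]
    gcongr with i
    exact hev i
  calc ‖LinearMap.toContinuousLinearMap T‖ ^ (2 * p) ≤ √s ^ (2 * p) := by gcongr
    _ = t := by rw [pow_mul, Real.sq_sqrt hs0, hsp]

end LinearMap.IsSymmetric

/-- The signed sum of the rank one operators given by a family of vectors. -/
noncomputable def signedTensorSum {ι E : Type*} [Fintype ι] [NormedAddCommGroup E]
    [InnerProductSpace ℂ E] (h : ι → E) (ε : ι → ℤˣ) : E →L[ℂ] E :=
  ∑ i, (ε i : ℤ) • InnerProductSpace.rankOne ℂ (h i) (h i)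

/-! ### Trace moments of Rademacher sums of rank one operators -/

variable {ι : Type*} [Fintype ι]

theorem signedTensorSum_isSymmetric {E : Type*} [NormedAddCommGroup E]
    [InnerProductSpace ℂ E] (h : ι → E) (ε : ι → ℤˣ) :
    (signedTensorSum h ε : E →ₗ[ℂ] E).IsSymmetric := by
  intro x z
  simp only [signedTensorSum, ContinuousLinearMap.coe_coe, sum_inner, inner_sum,
    sum_apply, smul_apply, InnerProductSpace.rankOne_apply,
    ← Int.cast_smul_eq_zsmul ℂ, smul_smul, inner_smul_left, inner_smul_right]
  refine Finset.sum_congr rfl fun i _ => ?_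
  simp
  ring

variable [DecidableEq ι]

/-- Flipping the sign at one index, as a permutation of the sign vectors. -/
def flipSign (i : ι) : Equiv.Perm (ι → ℤˣ) :=
  Equiv.mulRight (Pi.mulSingle i (-1))

theorem signedTensorSum_sub_flipSign {E : Type*} [NormedAddCommGroup E]
    [InnerProductSpace ℂ E] (h : ι → E) (ε : ι → ℤˣ) (i : ι) :
    signedTensorSum h ε - signedTensorSum h (flipSign i ε)
      = (2 * (ε i : ℤ)) • InnerProductSpace.rankOne ℂ (h i) (h i) := by
  rw [signedTensorSum, signedTensorSum, ← Finset.sum_sub_distrib, Finset.sum_eq_single i]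
  · simp [flipSign, two_mul, add_smul]
  · intro j _ hj
    simp [flipSign, Pi.mulSingle_eq_of_ne hj]
  · simp

theorem trace_mul_rankOne (A : Module.End ℂ V) (v : V) :
    LinearMap.trace ℂ V (A * (InnerProductSpace.rankOne ℂ v v : V →L[ℂ] V).toLinearMap)
      = ⟪v, A v⟫_ℂ := by
  have : A * (InnerProductSpace.rankOne ℂ v v : V →L[ℂ] V).toLinearMap
      = (InnerProductSpace.rankOne ℂ (A v) v : V →L[ℂ] V).toLinearMap := by
    ext z; simp
  rw [this, InnerProductSpace.trace_rankOne]

/-- Integration by parts in the sign `ε i`. Flipping it permutes the sign vectors, so the left side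
is half the sum of `ε i` times the difference between the values at `ε` and at its flip. The
telescoped difference of powers has 2p + 1 terms, each with 2 ε i • (h i ⊗ h i) in the middle; it
therefore splits into a product of two quadratic forms, and the signs square to one. -/
theorem sum_sign_mul_re_inner_pow_le (h : ι → V) (i : ι) (p : ℕ) :
    ∑ ε : ι → ℤˣ, ((ε i : ℤ) : ℝ) *
        (⟪h i, ((signedTensorSum h ε).toLinearMap ^ (2 * p + 1)) (h i)⟫_ℂ).re
      ≤ (2 * p + 1) * ‖h i‖ ^ 2 *
        ∑ ε : ι → ℤˣ, (⟪h i, ((signedTensorSum h ε).toLinearMap ^ (2 * p)) (h i)⟫_ℂ).re := by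
  set X : (ι → ℤˣ) → Module.End ℂ V := fun ε => (signedTensorSum h ε).toLinearMap with hX
  have hsymm : ∀ ε, (X ε).IsSymmetric := fun ε => signedTensorSum_isSymmetric h ε
  set f : (ι → ℤˣ) → ℕ → ℝ := fun ε q => (⟪h i, (X ε ^ q) (h i)⟫_ℂ).re with hf
  have hdiff : ∀ ε, ((ε i : ℤ) : ℝ) * (f ε (2 * p + 1) - f (flipSign i ε) (2 * p + 1))
      = 2 * ∑ q ∈ Finset.range (2 * p + 1), f ε q * f (flipSign i ε) (2 * p - q) := by
    intro ε
    have hsub : X ε - X (flipSign i ε)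
        = (2 * (ε i : ℤ)) • (InnerProductSpace.rankOne ℂ (h i) (h i)).toLinearMap := by
      exact LinearMap.ext fun z => DFunLike.congr_fun (signedTensorSum_sub_flipSign h ε i) z
    have hterm : ∀ q, (⟪h i, (X ε ^ q * (X ε - X (flipSign i ε)) *
          X (flipSign i ε) ^ (2 * p - q)) (h i)⟫_ℂ).re
        = 2 * ((ε i : ℤ) : ℝ) * (f ε q * f (flipSign i ε) (2 * p - q)) := by
      intro q
      -- Both quadratic forms are real, so the real part of their product is the product of real
      -- parts.
      have h1 := (hsymm ε).im_inner_pow_apply_self q (h i)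
      have h2 := (hsymm (flipSign i ε)).im_inner_pow_apply_self (2 * p - q) (h i)
      rw [hsub]
      simp only [Module.End.mul_apply, LinearMap.smul_apply, ContinuousLinearMap.coe_coe,
        InnerProductSpace.rankOne_apply, ← Int.cast_smul_eq_zsmul ℂ, smul_smul, map_smul,
        inner_smul_right, Complex.mul_re, Complex.mul_im, h1, h2, hf]
      simp
      ring
    have hsq : ((ε i : ℤ) : ℝ) * ((ε i : ℤ) : ℝ) = 1 := by
      rcases Int.units_eq_one_or (ε i) with h | h <;> simp [h]
    have hexp : f ε (2 * p + 1) - f (flipSign i ε) (2 * p + 1)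
        = 2 * ((ε i : ℤ) : ℝ) *
          ∑ q ∈ Finset.range (2 * p + 1), f ε q * f (flipSign i ε) (2 * p - q) := by
      rw [hf, ← Complex.sub_re, ← inner_sub_right, ← LinearMap.sub_apply,
        pow_sub_pow_eq_sum_mul_sub_mul, LinearMap.sum_apply, inner_sum, Complex.re_sum,
        Finset.mul_sum]
      exact Finset.sum_congr rfl fun q _ => by rw [Nat.add_sub_cancel]; exact hterm q
    rw [hexp]
    linear_combination (2 * ∑ q ∈ Finset.range (2 * p + 1),
      f ε q * f (flipSign i ε) (2 * p - q)) * hsq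
  have hle : ∀ ε, ((ε i : ℤ) : ℝ) * (f ε (2 * p + 1) - f (flipSign i ε) (2 * p + 1))
      ≤ (2 * p + 1) * ‖h i‖ ^ 2 * (f ε (2 * p) + f (flipSign i ε) (2 * p)) := by
    intro ε
    -- The factor 2 supplies a second copy of the sum; reflecting it pairs q with 2p - q, the
    -- symmetric form that the two-operator inequality bounds.
    rw [hdiff, two_mul]
    nth_rw 2 [← Finset.sum_range_reflect]
    rw [← Finset.sum_add_distrib]
    calc _ ≤ ∑ q ∈ Finset.range (2 * p + 1),
          ‖h i‖ ^ 2 * (f ε (2 * p) + f (flipSign i ε) (2 * p)) := by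
          refine Finset.sum_le_sum fun q hq => ?_
          have hq' : q ≤ 2 * p := by have := Finset.mem_range.1 hq; omega
          have e1 : 2 * p + 1 - 1 - q = 2 * p - q := by omega
          have e2 : 2 * p - (2 * p - q) = q := by omega
          have e3 : q + (2 * p - q) = 2 * p := by omega
          have := (hsymm ε).re_inner_pow_mul_re_inner_pow_le (hsymm (flipSign i ε))
            (q := q) (m := 2 * p - q) (by rw [e3]; exact even_two_mul p) (h i)
          rw [e3] at this
          rw [e1, e2]
          exact this
      _ = _ := by
          rw [Finset.sum_const, Finset.card_range, nsmul_eq_mul]; push_cast; ring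
  have hflip : ∀ ε : ι → ℤˣ, ((flipSign i ε i : ℤ) : ℝ) = -((ε i : ℤ) : ℝ) := fun ε => by
    simp [flipSign]
  have hsum := Finset.sum_le_sum fun ε (_ : ε ∈ (Finset.univ : Finset (ι → ℤˣ))) => hle ε
  have hL : ∑ ε : ι → ℤˣ, ((ε i : ℤ) : ℝ) * f (flipSign i ε) (2 * p + 1)
      = -∑ ε : ι → ℤˣ, ((ε i : ℤ) : ℝ) * f ε (2 * p + 1) := by
    rw [← Equiv.sum_comp (flipSign i) fun ε : ι → ℤˣ => ((ε i : ℤ) : ℝ) * f ε (2 * p + 1),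
      ← Finset.sum_neg_distrib]
    exact Finset.sum_congr rfl fun ε _ => by rw [hflip]; ring
  have hR : ∑ ε : ι → ℤˣ, f (flipSign i ε) (2 * p) = ∑ ε : ι → ℤˣ, f ε (2 * p) :=
    Equiv.sum_comp (flipSign i) fun ε => f ε (2 * p)
  simp only [mul_sub, Finset.sum_sub_distrib] at hsum
  rw [← Finset.mul_sum, Finset.sum_add_distrib, hL, hR] at hsum
  linarith

omit [DecidableEq ι] in
-- With S the unsigned sum, the left side is the trace of T^p S T^p. In an orthonormal basis each
-- diagonal entry is at most ‖S‖ ‖T^p b_j‖², and the ‖T^p b_j‖² add up to the trace of T^(2p).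
theorem sum_re_inner_pow_two_mul_le (h : ι → V) (T : Module.End ℂ V) (hT : T.IsSymmetric) (p : ℕ) :
    ∑ i, (⟪h i, (T ^ (2 * p)) (h i)⟫_ℂ).re
      ≤ ‖signedTensorSum h 1‖ * (LinearMap.trace ℂ V (T ^ (2 * p))).re := by
  set b := stdOrthonormalBasis ℂ V
  have h1 : ∀ v, (⟪v, (T ^ (2 * p)) v⟫_ℂ).re = ‖(T ^ p) v‖ ^ 2 := fun v => by
    rw [two_mul, pow_add, Module.End.mul_apply, ← hT.pow p, ← inner_self_eq_norm_sq (𝕜 := ℂ)]; rfl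
  rw [LinearMap.trace_eq_sum_inner _ b, Complex.re_sum, Finset.mul_sum]
  have h2 : ∑ i, (⟪h i, (T ^ (2 * p)) (h i)⟫_ℂ).re
      = ∑ j, (⟪(T ^ p) (b j), signedTensorSum h 1 ((T ^ p) (b j))⟫_ℂ).re := by
    have : ∀ i, (⟪h i, (T ^ (2 * p)) (h i)⟫_ℂ).re = ∑ j, ‖⟪(T ^ p) (b j), h i⟫_ℂ‖ ^ 2 := fun i => by
      rw [h1, ← b.sum_sq_norm_inner_right]
      exact Finset.sum_congr rfl fun j _ => by rw [hT.pow p]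
    simp only [this]
    rw [Finset.sum_comm]
    refine Finset.sum_congr rfl fun j _ => ?_
    simp only [signedTensorSum, sum_apply, inner_sum, Complex.re_sum]
    refine Finset.sum_congr rfl fun i _ => ?_
    simp only [Pi.one_apply, Units.val_one, one_smul, InnerProductSpace.rankOne_apply,
      inner_smul_right]
    rw [← inner_conj_symm (h i), Complex.conj_mul', ← Complex.ofReal_pow, Complex.ofReal_re]
  rw [h2]
  refine Finset.sum_le_sum fun j _ => ?_
  rw [h1]
  refine (Complex.re_le_norm _).trans ((norm_inner_le_norm _ _).trans ?_)
  have := (signedTensorSum h 1).le_opNorm ((T ^ p) (b j))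
  calc _ ≤ ‖(T ^ p) (b j)‖ * (‖signedTensorSum h 1‖ * ‖(T ^ p) (b j)‖) := by gcongr
    _ = _ := by ring

/-- Expanding one factor of the power gives the terms of `sum_sign_mul_re_inner_pow_le`. What
remains after integration by parts is a sum over `i` of quadratic forms of an even power, which
costs a factor ‖S‖. -/
theorem sum_re_trace_pow_succ_le (h : ι → V) {M : ℝ} (hM : ∀ i, ‖h i‖ ≤ M) (p : ℕ) :
    ∑ ε : ι → ℤˣ, (LinearMap.trace ℂ V ((signedTensorSum h ε).toLinearMap ^ (2 * (p + 1)))).re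
      ≤ (2 * p + 1) * (M ^ 2 * ‖signedTensorSum h 1‖) *
        ∑ ε : ι → ℤˣ, (LinearMap.trace ℂ V ((signedTensorSum h ε).toLinearMap ^ (2 * p))).re := by
  have hsymm : ∀ ε, ((signedTensorSum h ε).toLinearMap).IsSymmetric :=
    fun ε => signedTensorSum_isSymmetric h ε
  have h0 : ∀ ε i, 0 ≤ (⟪h i, ((signedTensorSum h ε).toLinearMap ^ (2 * p)) (h i)⟫_ℂ).re :=
    fun ε i => by
      rw [(hsymm ε).re_inner_pow_apply_self]
      exact Finset.sum_nonneg fun j _ =>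
        mul_nonneg ((even_two_mul p).pow_nonneg _) (sq_nonneg _)
  have hexp : ∀ ε, (LinearMap.trace ℂ V ((signedTensorSum h ε).toLinearMap ^ (2 * (p + 1)))).re
      = ∑ i, ((ε i : ℤ) : ℝ) *
        (⟪h i, ((signedTensorSum h ε).toLinearMap ^ (2 * p + 1)) (h i)⟫_ℂ).re := by
    intro ε
    have : (signedTensorSum h ε).toLinearMap ^ (2 * (p + 1))
        = ∑ i, (ε i : ℤ) • ((signedTensorSum h ε).toLinearMap ^ (2 * p + 1) *
          (InnerProductSpace.rankOne ℂ (h i) (h i) : V →L[ℂ] V).toLinearMap) := by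
      rw [show 2 * (p + 1) = 2 * p + 1 + 1 by ring, pow_succ]
      simp only [← mul_smul_comm, ← Finset.mul_sum]
      congr 1
      exact LinearMap.ext fun z => by simp [signedTensorSum, -zsmul_eq_mul]
    rw [this, map_sum, Complex.re_sum]
    refine Finset.sum_congr rfl fun i _ => ?_
    rw [map_zsmul, trace_mul_rankOne]
    simp
  simp only [hexp]
  rw [Finset.sum_comm]
  calc _ ≤ ∑ i, (2 * p + 1) * M ^ 2 *
        ∑ ε : ι → ℤˣ, (⟪h i, ((signedTensorSum h ε).toLinearMap ^ (2 * p)) (h i)⟫_ℂ).re := by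
        refine Finset.sum_le_sum fun i _ => (sum_sign_mul_re_inner_pow_le h i p).trans ?_
        have := Finset.sum_nonneg fun ε (_ : ε ∈ (Finset.univ : Finset (ι → ℤˣ))) => h0 ε i
        gcongr
        exact hM i
    _ = (2 * p + 1) * M ^ 2 * ∑ ε : ι → ℤˣ,
        ∑ i, (⟪h i, ((signedTensorSum h ε).toLinearMap ^ (2 * p)) (h i)⟫_ℂ).re := by
        rw [← Finset.mul_sum, Finset.sum_comm]
    _ ≤ (2 * p + 1) * M ^ 2 * ∑ ε : ι → ℤˣ, ‖signedTensorSum h 1‖ *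
        (LinearMap.trace ℂ V ((signedTensorSum h ε).toLinearMap ^ (2 * p))).re := by
        gcongr with ε
        exact sum_re_inner_pow_two_mul_le h _ (hsymm ε) p
    _ = _ := by rw [← Finset.mul_sum]; ring

/-- Even trace moments of a Rademacher sum of rank one operators are bounded by those of a Gaussian
variable of variance `M ^ 2 * ‖∑ h i ⊗ h i‖`. -/
theorem sum_re_trace_pow_le (h : ι → V) {M : ℝ} (hM : ∀ i, ‖h i‖ ≤ M) (p : ℕ) :
    ∑ ε : ι → ℤˣ, (LinearMap.trace ℂ V ((signedTensorSum h ε).toLinearMap ^ (2 * p))).re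
      ≤ 2 ^ Fintype.card ι * Module.finrank ℂ V *
        ((2 * p).factorial / (2 ^ p * p.factorial)) * (M ^ 2 * ‖signedTensorSum h 1‖) ^ p := by
  induction p with
  | zero => simp [Fintype.card_pi]
  | succ p ih =>
    refine (sum_re_trace_pow_succ_le h hM p).trans ?_
    -- The constant (2p)!/(2^p p!) is the double factorial (2p-1)!!, so the factor 2p + 1 advances
    -- it to the next one.
    calc _ ≤ (2 * p + 1) * (M ^ 2 * ‖signedTensorSum h 1‖) * (2 ^ Fintype.card ι *
          Module.finrank ℂ V * ((2 * p).factorial / (2 ^ p * p.factorial)) *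
          (M ^ 2 * ‖signedTensorSum h 1‖) ^ p) := by gcongr
      _ = _ := by
        rw [show 2 * (p + 1) = 2 * p + 1 + 1 by ring, Nat.factorial_succ, Nat.factorial_succ,
          Nat.factorial_succ]
        push_cast
        field_simp
        ring

/-! ### Exponential moments of Rademacher sums -/

theorem sum_cosh_norm_signedTensorSum_le [Nontrivial V] (h : ι → V) {M : ℝ} (hM : ∀ i, ‖h i‖ ≤ M)
    (θ : ℝ) :
    ∑ ε : ι → ℤˣ, Real.cosh (θ * ‖signedTensorSum h ε‖)
      ≤ 2 ^ Fintype.card ι * Module.finrank ℂ V *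
        Real.exp (θ ^ 2 * (M ^ 2 * ‖signedTensorSum h 1‖) / 2) := by
  -- The cosh series involves only even moments, and its 1/(2p)! cancels the (2p)! of the moment
  -- bound. The comparison with the exponential series is coefficientwise.
  have hL : HasSum (fun p : ℕ => ∑ ε : ι → ℤˣ, (θ * ‖signedTensorSum h ε‖) ^ (2 * p) /
      ((2 * p).factorial : ℝ)) (∑ ε : ι → ℤˣ, Real.cosh (θ * ‖signedTensorSum h ε‖)) :=
    hasSum_sum fun ε _ => Real.hasSum_cosh _
  have hE := (NormedSpace.expSeries_div_hasSum_exp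
    (θ ^ 2 * (M ^ 2 * ‖signedTensorSum h 1‖) / 2)).mul_left
    (2 ^ Fintype.card ι * Module.finrank ℂ V : ℝ)
  rw [← Real.exp_eq_exp_ℝ] at hE
  refine hasSum_le (fun p => ?_) hL hE
  have hp : ∑ ε : ι → ℤˣ, ‖signedTensorSum h ε‖ ^ (2 * p)
      ≤ ∑ ε : ι → ℤˣ,
        (LinearMap.trace ℂ V ((signedTensorSum h ε).toLinearMap ^ (2 * p))).re := by
    refine Finset.sum_le_sum fun ε _ => ?_
    rcases eq_or_ne p 0 with rfl | hp
    -- At p = 0 the claim is that the dimension is at least 1, which is where nontriviality of `V`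
    -- enters.
    · have : 1 ≤ Module.finrank ℂ V := Module.finrank_pos
      simpa using this
    · exact (signedTensorSum_isSymmetric h ε).norm_pow_two_mul_le_re_trace p hp
  have hθ : 0 ≤ θ ^ (2 * p) := (even_two_mul p).pow_nonneg _
  calc _ = θ ^ (2 * p) / ((2 * p).factorial : ℝ) *
        ∑ ε : ι → ℤˣ, ‖signedTensorSum h ε‖ ^ (2 * p) := by
        rw [Finset.mul_sum]
        exact Finset.sum_congr rfl fun ε _ => by rw [mul_pow]; ring
    _ ≤ θ ^ (2 * p) / ((2 * p).factorial : ℝ) * (2 ^ Fintype.card ι * Module.finrank ℂ V *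
        ((2 * p).factorial / (2 ^ p * p.factorial)) * (M ^ 2 * ‖signedTensorSum h 1‖) ^ p) := by
        gcongr
        exact hp.trans (sum_re_trace_pow_le h hM p)
    _ = _ := by
        have : ((2 * p).factorial : ℝ) ≠ 0 := by positivity
        have : (p.factorial : ℝ) ≠ 0 := by positivity
        rw [div_pow, mul_pow (θ ^ 2), ← pow_mul θ]
        field_simp

end FiniteDimensional

/-- The exponential moment of a Rademacher sum of `n` rank one operators on a Hilbert space is
bounded independently of the dimension of the space. -/
theorem sum_exp_norm_signedTensorSum_le {ι E : Type*} [Fintype ι] [DecidableEq ι] [Nonempty ι]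
    [NormedAddCommGroup E] [InnerProductSpace ℂ E] (h : ι → E) {M : ℝ} (hM : ∀ i, ‖h i‖ ≤ M)
    (θ : ℝ) :
    ∑ ε : ι → ℤˣ, Real.exp (θ * ‖signedTensorSum h ε‖)
      ≤ 2 * (2 ^ Fintype.card ι * Fintype.card ι *
        Real.exp (θ ^ 2 * (M ^ 2 * ‖signedTensorSum h 1‖) / 2)) := by
  -- The operators vanish on the orthogonal complement of this span and map into it, so restriction
  -- keeps their norms while the dimension drops to at most `Fintype.card ι`.
  set U := Submodule.span ℂ (Set.range h)
  have hfd : FiniteDimensional ℂ U := FiniteDimensional.span_of_finite ℂ (Set.finite_range h)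
  have hrank : Module.finrank ℂ U ≤ Fintype.card ι := finrank_range_le_card h
  set g : ι → U := fun i => ⟨h i, Submodule.subset_span ⟨i, rfl⟩⟩
  have hcoe : ∀ ε (u : U), ((signedTensorSum g ε u : U) : E) = signedTensorSum h ε u := by
    intro ε u
    simp [signedTensorSum, sum_apply, g, U, -zsmul_eq_mul]
  have hproj : ∀ ε (z : E), signedTensorSum h ε z
      = signedTensorSum h ε (U.orthogonalProjectionOnto z : E) := by
    intro ε z
    simp only [signedTensorSum, sum_apply, smul_apply, InnerProductSpace.rankOne_apply]
    refine Finset.sum_congr rfl fun i _ => ?_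
    have := U.inner_orthogonalProjectionOnto_eq_of_mem_left (g i) z
    rw [show h i = (g i : E) from rfl, ← this]
    rfl
  have hnorm : ∀ ε, ‖signedTensorSum g ε‖ = ‖signedTensorSum h ε‖ := by
    intro ε
    refine le_antisymm (ContinuousLinearMap.opNorm_le_bound _ (norm_nonneg _) fun u => ?_)
      (ContinuousLinearMap.opNorm_le_bound _ (norm_nonneg _) fun z => ?_)
    · change ‖((signedTensorSum g ε u : U) : E)‖ ≤ _ * ‖(u : E)‖
      rw [hcoe]
      exact (signedTensorSum h ε).le_opNorm u
    · rw [hproj, ← hcoe]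
      change ‖signedTensorSum g ε _‖ ≤ _
      refine (ContinuousLinearMap.le_opNorm _ _).trans ?_
      gcongr
      exact U.norm_orthogonalProjectionOnto_apply_le z
  have h2 : ∑ ε : ι → ℤˣ, Real.exp (θ * ‖signedTensorSum h ε‖)
      ≤ 2 * ∑ ε : ι → ℤˣ, Real.cosh (θ * ‖signedTensorSum h ε‖) := by
    rw [Finset.mul_sum]
    refine Finset.sum_le_sum fun ε _ => ?_
    rw [Real.cosh_eq]
    have := Real.exp_pos (-(θ * ‖signedTensorSum h ε‖))
    linarith
  refine h2.trans ?_
  gcongr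
  rcases subsingleton_or_nontrivial U with hU | hU
  · have hz : ∀ ε, ‖signedTensorSum h ε‖ = 0 := fun ε => by
      rw [← hnorm, Subsingleton.elim (signedTensorSum g ε) 0, norm_zero]
    have : (1 : ℝ) ≤ Fintype.card ι := by exact_mod_cast Fintype.card_pos
    simp only [hz]
    simp [Fintype.card_pi]
    simpa using this
  · have := sum_cosh_norm_signedTensorSum_le g (M := M) (fun i => hM i) θ
    simp only [hnorm] at this
    refine this.trans ?_
    gcongr

theorem integrable_exp_of_ae_le {α : Type*} [MeasurableSpace α] {μ : Measure α} [IsFiniteMeasure μ]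
    {f : α → ℝ} (hf : AEStronglyMeasurable f μ) (C : ℝ) (hC : ∀ᵐ x ∂μ, f x ≤ C) :
    Integrable (fun x => Real.exp (f x)) μ := by
  refine Integrable.of_bound (Real.continuous_exp.comp_aestronglyMeasurable hf) (Real.exp C) ?_
  filter_upwards [hC] with x hx
  rw [Real.norm_eq_abs, Real.abs_exp]
  exact Real.exp_le_exp.2 hx

/-! ### Symmetrization with an independent copy -/

section Symmetrization

variable {ι E : Type*} [Fintype ι] [NormedAddCommGroup E] [InnerProductSpace ℂ E]

theorem continuous_rankOne_self : Continuous fun v : E => InnerProductSpace.rankOne ℂ v v :=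
  ((ContinuousLinearMap.smulRightL ℂ E E).continuous.comp (innerSL ℂ).continuous).clm_apply
    continuous_id

theorem continuous_signedTensorSum (ε : ι → ℤˣ) :
    Continuous fun x : ι → E => signedTensorSum x ε :=
  continuous_finsetSum _ fun i _ =>
    (continuous_rankOne_self.comp (continuous_apply i)).const_smul (ε i : ℤ)

theorem norm_signedTensorSum_le {x : ι → E} {M : ℝ} (hx : ∀ i, ‖x i‖ ≤ M) (ε : ι → ℤˣ) :
    ‖signedTensorSum x ε‖ ≤ Fintype.card ι * M ^ 2 := by
  refine (norm_sum_le_of_le (f := fun i => (ε i : ℤ) • InnerProductSpace.rankOne ℂ (x i) (x i))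
    (n := fun _ => M ^ 2) _ fun i _ => ?_).trans_eq (by simp)
  have : ‖(ε i : ℤ) • InnerProductSpace.rankOne ℂ (x i) (x i)‖ = ‖x i‖ ^ 2 := by
    rcases Int.units_eq_one_or (ε i) with h | h <;> simp [h, pow_two, -zsmul_eq_mul]
  rw [this]
  have := hx i
  gcongr

/-- Exchange the two coordinates at the indices with negative sign. -/
def exchange (ε : ι → ℤˣ) (z : (ι → E) × (ι → E)) : (ι → E) × (ι → E) :=
  (fun i => if ε i = 1 then z.1 i else z.2 i, fun i => if ε i = 1 then z.2 i else z.1 i)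

theorem signedTensorSum_exchange (ε : ι → ℤˣ) (z : (ι → E) × (ι → E)) :
    signedTensorSum (exchange ε z).1 ε - signedTensorSum (exchange ε z).2 ε
      = signedTensorSum z.1 1 - signedTensorSum z.2 1 := by
  simp only [signedTensorSum, ← Finset.sum_sub_distrib]
  refine Finset.sum_congr rfl fun i _ => ?_
  rcases Int.units_eq_one_or (ε i) with h | h <;> simp [exchange, h, -zsmul_eq_mul, neg_add_eq_sub]

variable [MeasurableSpace E]

omit [NormedAddCommGroup E] [InnerProductSpace ℂ E] in
theorem measurePreserving_exchange (ν : Measure E) [IsProbabilityMeasure ν] (ε : ι → ℤˣ) :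
    MeasurePreserving (exchange ε)
      ((Measure.pi fun _ : ι => ν).prod (Measure.pi fun _ : ι => ν))
      ((Measure.pi fun _ : ι => ν).prod (Measure.pi fun _ : ι => ν)) := by
  have he := measurePreserving_arrowProdEquivProdArrow E E ι (fun _ => ν) fun _ => ν
  have hs : MeasurePreserving
      (fun (w : ι → E × E) i => (if ε i = 1 then id else Prod.swap : E × E → E × E) (w i))
      (Measure.pi fun _ => ν.prod ν) (Measure.pi fun _ => ν.prod ν) := by
    refine measurePreserving_pi _ _ fun i => ?_
    split_ifs
    · exact MeasurePreserving.id _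
    · exact Measure.measurePreserving_swap
  have h := he.comp (hs.comp (he.symm _))
  convert h using 1
  ext z i
  · by_cases hi : ε i = 1 <;>
      simp [exchange, MeasurableEquiv.arrowProdEquivProdArrow, Equiv.arrowProdEquivProdArrow, hi]
  · by_cases hi : ε i = 1 <;>
      simp [exchange, MeasurableEquiv.arrowProdEquivProdArrow, Equiv.arrowProdEquivProdArrow, hi]

omit [InnerProductSpace ℂ E] in
theorem ae_pi_norm_le {ν : Measure E} [IsProbabilityMeasure ν] {M : ℝ}
    (hM : ∀ᵐ v ∂ν, ‖v‖ ≤ M) : ∀ᵐ x ∂(Measure.pi fun _ : ι => ν), ∀ i, ‖x i‖ ≤ M :=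
  ae_all_iff.2 fun i => Measure.tendsto_eval_ae_ae (μ := fun _ : ι => ν) (i := i) |>.eventually hM

variable [BorelSpace E] [SecondCountableTopology E]

theorem integrable_rankOne_self {ν : Measure E} [IsProbabilityMeasure ν] {M : ℝ}
    (hM : ∀ᵐ v ∂ν, ‖v‖ ≤ M) : Integrable (fun v : E => InnerProductSpace.rankOne ℂ v v) ν := by
  refine Integrable.of_bound continuous_rankOne_self.aestronglyMeasurable (M ^ 2) ?_
  filter_upwards [hM] with v hv
  rw [InnerProductSpace.norm_rankOne, ← pow_two]
  gcongr

theorem integrable_signedTensorSum {ν : Measure E} [IsProbabilityMeasure ν] {M : ℝ}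
    (hM : ∀ᵐ v ∂ν, ‖v‖ ≤ M) (ε : ι → ℤˣ) :
    Integrable (fun x : ι → E => signedTensorSum x ε) (Measure.pi fun _ => ν) := by
  refine Integrable.of_bound (continuous_signedTensorSum ε).aestronglyMeasurable
    (Fintype.card ι * M ^ 2) ?_
  filter_upwards [ae_pi_norm_le hM] with x hx
  exact norm_signedTensorSum_le hx ε

theorem integral_signedTensorSum_one {ν : Measure E} [IsProbabilityMeasure ν] {M : ℝ}
    (hM : ∀ᵐ v ∂ν, ‖v‖ ≤ M) :
    ∫ x : ι → E, signedTensorSum x 1 ∂(Measure.pi fun _ => ν)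
      = (Fintype.card ι : ℝ) • ∫ v, InnerProductSpace.rankOne ℂ v v ∂ν := by
  have hI := integrable_rankOne_self hM
  simp only [signedTensorSum, Pi.one_apply, Units.val_one, one_smul]
  rw [integral_finsetSum _ fun i _ => integrable_comp_eval (μ := fun _ : ι => ν) hI]
  simp only [integral_comp_eval (μ := fun _ : ι => ν) hI.aestronglyMeasurable]
  simp [Nat.cast_smul_eq_nsmul]

variable {ν : Measure E} [IsProbabilityMeasure ν] {M : ℝ}

variable [CompleteSpace E]

/-- Symmetrization by random signs, for the exponential moment of the deviation from the mean. -/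
theorem integral_exp_norm_sub_mean_le (hM : ∀ᵐ v ∂ν, ‖v‖ ≤ M) {θ : ℝ} (hθ : 0 ≤ θ)
    (ε : ι → ℤˣ) :
    ∫ x : ι → E, Real.exp (θ * ‖signedTensorSum x 1 -
        (Fintype.card ι : ℝ) • ∫ v, InnerProductSpace.rankOne ℂ v v ∂ν‖) ∂(Measure.pi fun _ => ν)
      ≤ ∫ x : ι → E, Real.exp (2 * θ * ‖signedTensorSum x ε‖) ∂(Measure.pi fun _ => ν) := by
  set μ := Measure.pi fun _ : ι => ν
  set Γ := (Fintype.card ι : ℝ) • ∫ v, InnerProductSpace.rankOne ℂ v v ∂ν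
  set C : ℝ := Fintype.card ι * M ^ 2
  have hb : ∀ᵐ x ∂μ, ∀ ε : ι → ℤˣ, ‖signedTensorSum x ε‖ ≤ C := by
    filter_upwards [ae_pi_norm_le (ι := ι) hM] with x hx ε
    exact norm_signedTensorSum_le hx ε
  have hc := continuous_signedTensorSum (ι := ι) (E := E)
  have hb2 : ∀ᵐ z ∂μ.prod μ, ∀ ε : ι → ℤˣ,
      ‖signedTensorSum z.1 ε‖ ≤ C ∧ ‖signedTensorSum z.2 ε‖ ≤ C := by
    filter_upwards [Measure.quasiMeasurePreserving_fst.ae hb,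
      Measure.quasiMeasurePreserving_snd.ae hb] with z h1 h2 ε
    exact ⟨h1 ε, h2 ε⟩
  have hc2 : ∀ ε : ι → ℤˣ, Continuous fun z : (ι → E) × (ι → E) =>
      signedTensorSum z.1 ε - signedTensorSum z.2 ε := fun ε =>
    ((hc ε).comp continuous_fst).sub ((hc ε).comp continuous_snd)
  have hI2 : ∀ ε : ι → ℤˣ, Integrable (fun z : (ι → E) × (ι → E) =>
      Real.exp (θ * ‖signedTensorSum z.1 ε - signedTensorSum z.2 ε‖)) (μ.prod μ) := fun ε => by
    refine integrable_exp_of_ae_le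
      (continuous_const.mul (hc2 ε).norm).aestronglyMeasurable (θ * (C + C)) ?_
    filter_upwards [hb2] with z hz
    exact mul_le_mul_of_nonneg_left
      ((norm_sub_le _ _).trans (add_le_add (hz ε).1 (hz ε).2)) hθ
  have hI1 : Integrable (fun x : ι → E => Real.exp (2 * θ * ‖signedTensorSum x ε‖)) μ := by
    refine integrable_exp_of_ae_le
      (continuous_const.mul (hc ε).norm).aestronglyMeasurable (2 * θ * C) ?_
    filter_upwards [hb] with x hx
    exact mul_le_mul_of_nonneg_left (hx ε) (by positivity)
  -- The mean Γ is the integral over an independent copy `x'`; Jensen moves that integral outside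
  -- the norm and the exponential.
  have hjensen : ∀ᵐ x ∂μ, Real.exp (θ * ‖signedTensorSum x 1 - Γ‖)
      ≤ ∫ x', Real.exp (θ * ‖signedTensorSum x 1 - signedTensorSum x' 1‖) ∂μ := by
    filter_upwards [hb] with x hx
    have hS := integrable_signedTensorSum (ι := ι) hM 1
    have hsub : Integrable (fun x' => signedTensorSum x 1 - signedTensorSum x' 1) μ :=
      (integrable_const _).sub hS
    have h1 : signedTensorSum x 1 - Γ = ∫ x', (signedTensorSum x 1 - signedTensorSum x' 1) ∂μ := by
      rw [integral_sub (integrable_const _) hS, integral_const, probReal_univ, one_smul,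
        integral_signedTensorSum_one hM]
    have h2 : θ * ‖signedTensorSum x 1 - Γ‖
        ≤ ∫ x', θ * ‖signedTensorSum x 1 - signedTensorSum x' 1‖ ∂μ := by
      rw [integral_const_mul, h1]
      exact mul_le_mul_of_nonneg_left (norm_integral_le_integral_norm _) hθ
    refine (Real.exp_le_exp.2 h2).trans (convexOn_exp.map_integral_le
      Real.continuous_exp.continuousOn isClosed_univ (by simp) (hsub.norm.const_mul θ) ?_)
    refine integrable_exp_of_ae_le (hsub.norm.const_mul θ).aestronglyMeasurable (θ * (C + C)) ?_
    filter_upwards [hb] with x' hx'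
    exact mul_le_mul_of_nonneg_left ((norm_sub_le _ _).trans (add_le_add (hx 1) (hx' 1))) hθ
  have hDint : Integrable (fun x : ι → E => Real.exp (θ * ‖signedTensorSum x 1 - Γ‖)) μ := by
    refine integrable_exp_of_ae_le
      (continuous_const.mul ((hc 1).sub continuous_const).norm).aestronglyMeasurable
      (θ * (C + ‖Γ‖)) ?_
    filter_upwards [hb] with x hx
    exact mul_le_mul_of_nonneg_left ((norm_sub_le _ _).trans (add_le_add (hx 1) le_rfl)) hθ
  calc _ ≤ ∫ x, ∫ x', Real.exp (θ * ‖signedTensorSum x 1 - signedTensorSum x' 1‖) ∂μ ∂μ :=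
        integral_mono_ae hDint (hI2 1).integral_prod_left hjensen
    _ = ∫ z, Real.exp (θ * ‖signedTensorSum z.1 1 - signedTensorSum z.2 1‖) ∂μ.prod μ :=
        (integral_prod _ (hI2 1)).symm
    -- Swapping the two copies at the indices of negative sign preserves the product measure and
    -- introduces the signs.
    _ = ∫ z, Real.exp (θ * ‖signedTensorSum z.1 ε - signedTensorSum z.2 ε‖) ∂μ.prod μ := by
        have hΦ := measurePreserving_exchange ν ε
        nth_rw 2 [← hΦ.map_eq]
        rw [integral_map hΦ.measurable.aemeasurable]
        · simp only [signedTensorSum_exchange]; rfl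
        · rw [hΦ.map_eq]; exact (hI2 ε).aestronglyMeasurable
    -- Triangle inequality, then uv ≤ (u² + v²)/2; the squares double the parameter.
    _ ≤ ∫ z, (Real.exp (2 * θ * ‖signedTensorSum z.1 ε‖)
          + Real.exp (2 * θ * ‖signedTensorSum z.2 ε‖)) / 2 ∂μ.prod μ := by
        refine integral_mono (hI2 ε) (((hI1.comp_fst μ).add (hI1.comp_snd μ)).div_const 2)
          fun z => ?_
        set a := ‖signedTensorSum z.1 ε‖
        set b := ‖signedTensorSum z.2 ε‖
        have h1 : Real.exp (θ * ‖signedTensorSum z.1 ε - signedTensorSum z.2 ε‖)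
            ≤ Real.exp (θ * a) * Real.exp (θ * b) := by
          rw [← Real.exp_add, ← mul_add]
          exact Real.exp_le_exp.2 (mul_le_mul_of_nonneg_left (norm_sub_le _ _) hθ)
        have h2 : ∀ c, Real.exp (2 * θ * c) = Real.exp (θ * c) ^ 2 := fun c => by
          rw [← Real.exp_nat_mul]; congr 1; push_cast; ring
        simp only [h2]
        nlinarith [sq_nonneg (Real.exp (θ * a) - Real.exp (θ * b))]
    _ = _ := by
        rw [integral_div, integral_add (hI1.comp_fst μ) (hI1.comp_snd μ),
          integral_fun_fst (μ := μ) (ν := μ) (fun x => Real.exp (2 * θ * ‖signedTensorSum x ε‖)),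
          integral_fun_snd (μ := μ) (ν := μ) (fun x => Real.exp (2 * θ * ‖signedTensorSum x ε‖))]
        simp

/-! ### The self-bounding exponential moment and the tail bound -/

variable [Nonempty ι]

/-- Symmetrization holds for every sign vector, so it may be averaged over all of them, and the
Rademacher bound at 2θ then applies for each fixed `x`. The gain is that the parameter on the right
is quadratic in θ, as (2θ)²/2 = 2θ². -/
theorem integral_exp_norm_sub_mean_le_integral_exp_norm (hM : ∀ᵐ v ∂ν, ‖v‖ ≤ M) {θ : ℝ}
    (hθ : 0 ≤ θ) :
    ∫ x : ι → E, Real.exp (θ * ‖signedTensorSum x 1 -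
        (Fintype.card ι : ℝ) • ∫ v, InnerProductSpace.rankOne ℂ v v ∂ν‖) ∂(Measure.pi fun _ => ν)
      ≤ 2 * Fintype.card ι * ∫ x : ι → E, Real.exp (2 * θ ^ 2 * M ^ 2 * ‖signedTensorSum x 1‖)
        ∂(Measure.pi fun _ => ν) := by
  classical
  set μ := Measure.pi fun _ : ι => ν
  have hb := ae_pi_norm_le (ι := ι) hM
  have hI : ∀ (ε : ι → ℤˣ) {c : ℝ}, 0 ≤ c →
      Integrable (fun x : ι → E => Real.exp (c * ‖signedTensorSum x ε‖)) μ := fun ε c hc => by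
    refine integrable_exp_of_ae_le (continuous_const.mul
      (continuous_signedTensorSum ε).norm).aestronglyMeasurable (c * (Fintype.card ι * M ^ 2)) ?_
    filter_upwards [hb] with x hx
    exact mul_le_mul_of_nonneg_left (norm_signedTensorSum_le hx ε) hc
  have h1 := Finset.sum_le_sum fun (ε : ι → ℤˣ) (_ : ε ∈ Finset.univ) =>
    integral_exp_norm_sub_mean_le hM hθ ε
  rw [← integral_finsetSum _ fun ε _ => hI ε (by positivity)] at h1
  have h2 : ∫ x : ι → E, ∑ ε : ι → ℤˣ, Real.exp (2 * θ * ‖signedTensorSum x ε‖) ∂μ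
      ≤ ∫ x : ι → E, 2 * (2 ^ Fintype.card ι * Fintype.card ι) *
        Real.exp (2 * θ ^ 2 * M ^ 2 * ‖signedTensorSum x 1‖) ∂μ := by
    refine integral_mono_ae (integrable_finsetSum _ fun ε _ => hI ε (by positivity))
      ((hI 1 (by positivity)).const_mul _) ?_
    filter_upwards [hb] with x hx
    refine (sum_exp_norm_signedTensorSum_le x hx (2 * θ)).trans_eq ?_
    rw [← mul_assoc]
    congr 2
    ring
  rw [integral_const_mul] at h2
  have h3 := h1.trans h2
  rw [Finset.sum_const, nsmul_eq_mul] at h3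
  simp only [Finset.card_univ, Fintype.card_pi, Fintype.card_units_int, Finset.prod_const,
    Nat.cast_pow, Nat.cast_ofNat] at h3
  refine le_of_mul_le_mul_left ?_ (by positivity : (0 : ℝ) < 2 ^ Fintype.card ι)
  linarith

/-- The exponential moment bound closes on itself for the parameter `1 / (8 * M ^ 2)`. -/
theorem integral_exp_norm_sub_mean_pow_three_le (hM0 : 0 < M) (hM : ∀ᵐ v ∂ν, ‖v‖ ≤ M) :
    (∫ x : ι → E, Real.exp (1 / (8 * M ^ 2) * ‖signedTensorSum x 1 -
        (Fintype.card ι : ℝ) • ∫ v, InnerProductSpace.rankOne ℂ v v ∂ν‖)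
          ∂(Measure.pi fun _ => ν)) ^ 3
      ≤ (2 * Fintype.card ι) ^ 4 * Real.exp (1 / (8 * M ^ 2) *
        ‖(Fintype.card ι : ℝ) • ∫ v, InnerProductSpace.rankOne ℂ v v ∂ν‖) := by
  set μ := Measure.pi fun _ : ι => ν
  set Γ := (Fintype.card ι : ℝ) • ∫ v, InnerProductSpace.rankOne ℂ v v ∂ν
  set θ : ℝ := 1 / (8 * M ^ 2) with hθdef
  have hθ : 0 < θ := by positivity
  set m := ∫ x : ι → E, Real.exp (θ * ‖signedTensorSum x 1 - Γ‖) ∂μ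
  set a := ∫ x : ι → E, Real.exp (θ / 4 * ‖signedTensorSum x 1 - Γ‖) ∂μ
  have hb := ae_pi_norm_le (ι := ι) hM
  have hI : ∀ {c : ℝ} (G : E →L[ℂ] E), 0 ≤ c →
      Integrable (fun x : ι → E => Real.exp (c * ‖signedTensorSum x 1 - G‖)) μ := fun {c} G hc => by
    refine integrable_exp_of_ae_le (continuous_const.mul
      ((continuous_signedTensorSum 1).sub continuous_const).norm).aestronglyMeasurable
      (c * (Fintype.card ι * M ^ 2 + ‖G‖)) ?_
    filter_upwards [hb] with x hx
    exact mul_le_mul_of_nonneg_left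
      ((norm_sub_le _ _).trans (add_le_add (norm_signedTensorSum_le hx 1) le_rfl)) hc
  have hm : 0 < m := integral_exp_pos (hI Γ hθ.le)
  -- Jensen for the fourth power, since the integrand of `m` is the fourth power of that of `a`.
  have ham : a ^ 4 ≤ m := by
    have h := (Even.convexOn_pow (𝕜 := ℝ) (n := 4) (by decide)).map_integral_le
      (μ := μ) (f := fun x => Real.exp (θ / 4 * ‖signedTensorSum x 1 - Γ‖))
      (continuous_pow 4).continuousOn isClosed_univ (by simp) (hI Γ (by positivity))
      (by
        refine (hI Γ hθ.le).congr (ae_of_all _ fun x => ?_)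
        simp only [Function.comp, ← Real.exp_nat_mul]
        congr 1; push_cast; ring)
    refine h.trans_eq (integral_congr_ae (ae_of_all _ fun x => ?_))
    simp only [← Real.exp_nat_mul]
    congr 1; push_cast; ring
  have h1 : m ≤ 2 * Fintype.card ι * (Real.exp (θ / 4 * ‖Γ‖) * a) := by
    refine (integral_exp_norm_sub_mean_le_integral_exp_norm hM hθ.le).trans ?_
    -- The choice of θ makes the parameter contract by exactly 4, matching the fourth power in
    -- `ham`.
    have : 2 * θ ^ 2 * M ^ 2 = θ / 4 := by rw [hθdef]; field_simp; norm_num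
    rw [this]
    refine mul_le_mul_of_nonneg_left ?_ (by positivity)
    rw [← integral_const_mul]
    refine integral_mono (by simpa using hI 0 (by positivity))
      ((hI Γ (by positivity)).const_mul _) fun x => ?_
    simp only [← Real.exp_add, ← mul_add]
    have : ‖signedTensorSum x 1‖ ≤ ‖Γ‖ + ‖signedTensorSum x 1 - Γ‖ := by
      simpa using norm_add_le Γ (signedTensorSum x 1 - Γ)
    gcongr
  have h4 : m ^ 4 ≤ (2 * Fintype.card ι) ^ 4 * Real.exp (θ * ‖Γ‖) * m := by
    calc m ^ 4 ≤ (2 * Fintype.card ι * (Real.exp (θ / 4 * ‖Γ‖) * a)) ^ 4 := by gcongr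
      _ = (2 * Fintype.card ι) ^ 4 * Real.exp (θ * ‖Γ‖) * a ^ 4 := by
        rw [mul_pow, mul_pow (Real.exp _), ← Real.exp_nat_mul, ← mul_assoc]
        congr 3; push_cast; ring
      _ ≤ _ := by gcongr
  exact le_of_mul_le_mul_right (by linarith [pow_succ m 3]) hm

/-- Markov's inequality at θ = 1/(8M²), cubed, gives the exponent -3θt. The term θ‖Γ‖ from the
moment bound is at most θt, leaving -2θt = -t/(4M²). -/
theorem measureReal_le_norm_sub_mean_pow_three_le (hM0 : 0 < M) (hM : ∀ᵐ v ∂ν, ‖v‖ ≤ M)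
    {Λ : E →L[ℂ] E} (hΛ : ∫ v, InnerProductSpace.rankOne ℂ v v ∂ν = Λ) {t : ℝ}
    (ht : ‖(Fintype.card ι : ℝ) • Λ‖ ≤ t) :
    (Measure.pi fun _ : ι => ν).real {x : ι → E | t ≤ ‖signedTensorSum x 1 -
        (Fintype.card ι : ℝ) • Λ‖} ^ 3
      ≤ (2 * Fintype.card ι) ^ 4 * Real.exp (-(t / (4 * M ^ 2))) := by
  set μ := Measure.pi fun _ : ι => ν
  have hcube := integral_exp_norm_sub_mean_pow_three_le (ι := ι) hM0 hM
  rw [hΛ] at hcube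
  set Γ := (Fintype.card ι : ℝ) • Λ
  set θ : ℝ := 1 / (8 * M ^ 2) with hθdef
  have hθ : 0 < θ := by positivity
  have hI : Integrable (fun x : ι → E => Real.exp (θ * ‖signedTensorSum x 1 - Γ‖)) μ := by
    refine integrable_exp_of_ae_le (continuous_const.mul
      ((continuous_signedTensorSum 1).sub continuous_const).norm).aestronglyMeasurable
      (θ * (Fintype.card ι * M ^ 2 + ‖Γ‖)) ?_
    filter_upwards [ae_pi_norm_le (ι := ι) hM] with x hx
    exact mul_le_mul_of_nonneg_left
      ((norm_sub_le _ _).trans (add_le_add (norm_signedTensorSum_le hx 1) le_rfl)) hθ.le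
  have h := measure_ge_le_exp_mul_mgf t hθ.le hI
  calc _ ≤ (Real.exp (-θ * t) * mgf (fun x : ι → E => ‖signedTensorSum x 1 - Γ‖) μ θ) ^ 3 := by
        gcongr
    _ = Real.exp (-(3 * θ * t)) *
        (mgf (fun x : ι → E => ‖signedTensorSum x 1 - Γ‖) μ θ) ^ 3 := by
        rw [mul_pow, ← Real.exp_nat_mul]; congr 2; push_cast; ring
    _ ≤ Real.exp (-(3 * θ * t)) * ((2 * Fintype.card ι) ^ 4 * Real.exp (θ * t)) := by
        gcongr
        refine hcube.trans ?_
        gcongr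
    _ = _ := by
        rw [mul_left_comm, ← Real.exp_add]
        congr 2
        rw [hθdef]
        field_simp
        ring

end Symmetrization

/-! ### Separability of ℓ₂, numerical slack and the conclusion -/

/-- The finite combinations of unit vectors are dense. Second countability makes the Borel σ-algebra
of a finite power of ℓ₂ the product one, as the measurability arguments require. -/
instance : SecondCountableTopology EllTwo := by
  have hsep : TopologicalSpace.IsSeparable (closure
      (Submodule.span ℂ (Set.range fun i : ℕ => (lp.single 2 i (1 : ℂ) : EllTwo)) : Set EllTwo)) :=
    (Set.countable_range _).isSeparable.span.closure
  have huniv : closure (Submodule.span ℂ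
      (Set.range fun i : ℕ => (lp.single 2 i (1 : ℂ) : EllTwo)) : Set EllTwo) = Set.univ := by
    refine Set.eq_univ_of_forall fun f => ?_
    have hf := lp.hasSum_single (E := fun _ : ℕ => ℂ) (p := 2) ENNReal.ofNat_ne_top f
    refine mem_closure_of_tendsto hf (Filter.Eventually.of_forall fun s => ?_)
    refine Submodule.sum_mem _ fun i _ => ?_
    have : (lp.single 2 i (f i) : EllTwo) = f i • (lp.single 2 i (1 : ℂ) : EllTwo) := by
      rw [← lp.single_smul]; simp
    rw [this]
    exact Submodule.smul_mem _ _ (Submodule.subset_span ⟨i, rfl⟩)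
  rw [huniv] at hsep
  have := TopologicalSpace.isSeparable_univ_iff.1 hsep
  exact UniformSpace.secondCountable_of_separable EllTwo

/-- The slack left after comparing cubes: 2⁴ exceeds the cube of 2^(3/4) by the factor 2^(7/4), and
n⁴ exceeds n³ by n. The exponent splits as √5 ≥ 11/5 = 6/5 + 1. -/
theorem two_rpow_mul_le_rpow {x r : ℝ} (hx : 3 ≤ x) (hr : 1 ≤ r) :
    (2 : ℝ) ^ (7 / 4 : ℝ) * x ≤ x ^ (√5 * r) := by
  have h5 : (11 / 5 : ℝ) ≤ √5 := Real.le_sqrt_of_sq_le (by norm_num)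
  have hx0 : 0 < x := by linarith
  have h1 : (2 : ℝ) ^ (7 / 4 : ℝ) ≤ 3 ^ (6 / 5 : ℝ) := by
    -- Twentieth powers clear the denominators, leaving 2^35 ≤ 3^24.
    refine le_of_pow_le_pow_left₀ (n := 20) (by norm_num) (by positivity) ?_
    rw [← Real.rpow_natCast, ← Real.rpow_natCast, ← Real.rpow_mul (by norm_num),
      ← Real.rpow_mul (by norm_num)]
    norm_num
  calc (2 : ℝ) ^ (7 / 4 : ℝ) * x ≤ x ^ (6 / 5 : ℝ) * x := by
        gcongr
        exact h1.trans (Real.rpow_le_rpow (by norm_num) hx (by norm_num))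
    _ = x ^ (11 / 5 : ℝ) := by
        rw [← Real.rpow_add_one hx0.ne']; norm_num
    _ ≤ _ := Real.rpow_le_rpow_of_exponent_le (by linarith) (by nlinarith)

theorem proposition3p6 {Ω : Type*} [MeasurableSpace Ω] (P : Measure Ω) [IsProbabilityMeasure P]
    (n : ℕ) (hn : 3 ≤ n) (r M : ℝ) (hr : 1 < r) (hM : 0 < M)
    (y : Fin n → Ω → EllTwo)
    (hmeas : ∀ i, Measurable (y i))
    (hindep : iIndepFun y P)
    (hident : ∀ i j, IdentDistrib (y i) (y j) P P)
    (hbound : ∀ i, ∀ᵐ ω ∂P, ‖y i ω‖ ≤ M)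
    (Λ : EllTwo →L[ℂ] EllTwo)
    (hΛ : ∀ i, ∫ ω, tensorSelf (y i ω) ∂P = Λ) :
    P.real {ω | max (8 * r * Real.log n / n * M ^ 2 * ((1 + √5) / 2) ^ 2) ‖Λ‖
        ≤ ‖((1 / (n : ℝ)) • (∑ i, tensorSelf (y i ω))) - Λ‖}
      ≤ (2 : ℝ) ^ (3 / 4 : ℝ) * (n : ℝ) ^ (1 - r) := by
  have hn3 : (3 : ℝ) ≤ n := by exact_mod_cast hn
  have hn0 : (0 : ℝ) < n := by linarith
  have : Nonempty (Fin n) := ⟨⟨0, by omega⟩⟩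
  set i₀ : Fin n := ⟨0, by omega⟩
  set ν := P.map (y i₀) with hν
  have : IsProbabilityMeasure ν := Measure.isProbabilityMeasure_map (hmeas i₀).aemeasurable
  have hlaw : P.map (fun ω i => y i ω) = Measure.pi fun _ : Fin n => ν := by
    rw [(iIndepFun_iff_map_fun_eq_pi_map fun i => (hmeas i).aemeasurable).1 hindep]
    congr 1
    funext i
    exact (hident i i₀).map_eq
  have hνM : ∀ᵐ v ∂ν, ‖v‖ ≤ M :=
    (ae_map_iff (hmeas i₀).aemeasurable (measurableSet_le measurable_norm measurable_const)).2
      (hbound i₀)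
  have hΛν : ∫ v, InnerProductSpace.rankOne ℂ v v ∂ν = Λ := by
    rw [hν, integral_map (hmeas i₀).aemeasurable continuous_rankOne_self.aestronglyMeasurable]
    exact hΛ i₀
  set F := max (8 * r * Real.log n / n * M ^ 2 * ((1 + √5) / 2) ^ 2) ‖Λ‖
  have hset : {ω | F ≤ ‖((1 / (n : ℝ)) • (∑ i, tensorSelf (y i ω))) - Λ‖}
      = (fun ω i => y i ω) ⁻¹'
        {x : Fin n → EllTwo | n * F ≤ ‖signedTensorSum x 1 - (n : ℝ) • Λ‖} := by
    ext ω
    have : (1 / (n : ℝ)) • (∑ i, tensorSelf (y i ω)) - Λ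
        = (1 / (n : ℝ)) • (signedTensorSum (fun i => y i ω) 1 - (n : ℝ) • Λ) := by
      rw [smul_sub, smul_smul, one_div_mul_cancel hn0.ne', one_smul]
      simp [signedTensorSum, tensorSelf]
    rw [Set.mem_ofPred_eq, this, norm_smul, Real.norm_of_nonneg (by positivity),
      Set.mem_preimage, Set.mem_ofPred_eq, one_div_mul_eq_div, le_div_iff₀' hn0]
  have hprob : P.real {ω | F ≤ ‖((1 / (n : ℝ)) • (∑ i, tensorSelf (y i ω))) - Λ‖}
      = (Measure.pi fun _ : Fin n => ν).real
        {x : Fin n → EllTwo | n * F ≤ ‖signedTensorSum x 1 - (n : ℝ) • Λ‖} := by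
    rw [hset, ← hlaw, map_measureReal_apply (measurable_pi_lambda _ hmeas)]
    exact (isClosed_le continuous_const
      ((continuous_signedTensorSum 1).sub continuous_const).norm).measurableSet
  have hcube : P.real {ω | F ≤ ‖((1 / (n : ℝ)) • (∑ i, tensorSelf (y i ω))) - Λ‖} ^ 3
      ≤ (2 * n) ^ 4 * Real.exp (-(n * F / (4 * M ^ 2))) := by
    have hnF : ‖(n : ℝ) • Λ‖ ≤ n * F := by
      rw [norm_smul, Real.norm_of_nonneg hn0.le]
      gcongr
      exact le_max_right _ _
    have h := measureReal_le_norm_sub_mean_pow_three_le (ι := Fin n) hM hνM hΛν (t := n * F)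
      (by rw [Fintype.card_fin]; exact hnF)
    rw [Fintype.card_fin] at h
    rw [hprob]
    exact h
  refine le_of_pow_le_pow_left₀ three_ne_zero (by positivity) (hcube.trans ?_)
  -- The first entry of the maximum contributes 8κ²/4 = 2κ² = 3 + √5; the second entry served to
  -- give ‖nΛ‖ ≤ nF.
  have hF : (3 + √5) * r * Real.log n ≤ n * F / (4 * M ^ 2) := by
    rw [le_div_iff₀ (by positivity)]
    have h1 : n * (8 * r * Real.log n / n * M ^ 2 * ((1 + √5) / 2) ^ 2) ≤ n * F := by
      gcongr; exact le_max_left _ _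
    refine le_trans (le_of_eq ?_) h1
    have h5 : √5 ^ 2 = 5 := Real.sq_sqrt (by norm_num)
    field_simp
    linear_combination (-8 * Real.log n) * h5
  have hexp : Real.exp (-(n * F / (4 * M ^ 2))) ≤ (n : ℝ) ^ (-((3 + √5) * r)) := by
    rw [Real.rpow_def_of_pos hn0]
    exact Real.exp_le_exp.2 (by linarith)
  calc _ ≤ (2 * (n : ℝ)) ^ 4 * (n : ℝ) ^ (-((3 + √5) * r)) := by gcongr
    _ = 2 ^ (9 / 4 : ℝ) * (n : ℝ) ^ (3 - (3 + √5) * r) * (2 ^ (7 / 4 : ℝ) * n) := by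
        have h2 : (2 : ℝ) ^ (9 / 4 : ℝ) * 2 ^ (7 / 4 : ℝ) = 2 ^ 4 := by
          rw [← Real.rpow_add two_pos]; norm_num
        have h3 : (n : ℝ) ^ (3 - (3 + √5) * r) = (n : ℝ) ^ 3 * (n : ℝ) ^ (-((3 + √5) * r)) := by
          rw [sub_eq_add_neg, Real.rpow_add hn0]; norm_num
        rw [h3, mul_pow]
        linear_combination (-(n : ℝ) ^ 4 * (n : ℝ) ^ (-((3 + √5) * r))) * h2
    _ ≤ 2 ^ (9 / 4 : ℝ) * (n : ℝ) ^ (3 - (3 + √5) * r) * (n : ℝ) ^ (√5 * r) := by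
        gcongr
        exact two_rpow_mul_le_rpow hn3 hr.le
    _ = _ := by
        rw [mul_assoc, ← Real.rpow_add hn0, mul_pow, ← Real.rpow_natCast (2 ^ (3 / 4 : ℝ)),
          ← Real.rpow_natCast ((n : ℝ) ^ (1 - r)), ← Real.rpow_mul two_pos.le,
          ← Real.rpow_mul hn0.le]
        congr 2
        · norm_num
        · push_cast; ring
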